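/- Consider a Markov decision process with finite state space $S$, finite action space $A$ and transition probabilities $p(s'|s,a)$. Let $\mu$ (behavior) and $\pi$ (target) be stationary randomized policies such that $\mu(a|s)=0$ implies $\pi(a|s)=0$. Let $s_0,a_0,s_1,a_1,\dots$ be generated by $a_t\sim\mu(\cdot|s_t)$, $s_{t+1}\sim p(\cdot|s_t,a_t)$, with an initial distribution such that $\Pr(s_t=s)\to d_\mu(s)$ for every $s$, where $d_\mu$ is a stationary distribution of the state chain induced by $\mu$ (for example $s_0\sim d_\mu$, or any initial distribution if that chain is irreducible and aperiodic). Let $\beta\in[0,1)$, $\rho_t=\pi(a_t|s_t)/\mu(a_t|s_t)$, and let the trace be $F_0=1$, $F_t=\beta\rho_{t-1}F_{t-1}+1$. Define the mismatch matrix $\tilde P_{\mu,\pi}$ by $$[\tilde P_{\mu,\pi}]_{\bar s s}=\sum_a p(s|\bar s,a)\,\frac{\pi^2(a|\bar s)}{\mu(a|\bar s)}$$ (terms with $\mu(a|\bar s)=0$ being $0$), let $\alpha(\mu,\pi)$ be the largest magnitude of its eigenvalues, and let $\|\tilde P_{\mu,\pi}\|_\infty$ be its $\ell_\infty$-induced norm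 (maximum absolute row sum). If $\beta<1/\sqrt{\alpha(\mu,\pi)}$, then for every state $s$ with $d_\mu(s)>0$ the limit $\lim_{t\to\infty}\mathrm{Var}[F_t\mid s_t=s]$ exists and is finite. If moreover $\beta^2\|\tilde P_{\mu,\pi}\|_\infty<1$, then $$\sum_{s:\,d_\mu(s)>0} d_\mu(s)\lim_{t\to\infty}\mathrm{Var}[F_t\mid s_t=s]\;\le\;\frac{\beta^2}{1-\beta}\left(2+\frac{(1+\beta)\|\tilde P_{\mu,\pi}\|_\infty}{1-\beta^2\|\tilde P_{\mu,\pi}\|_\infty}\right).$$ -/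

import Mathlib

open MeasureTheory ProbabilityTheory Filter Topology

noncomputable section

/-- The controlled transition law `p(s' | s, a)` of a Markov decision process with finite state
space `S` and finite action space `A`. (Rewards and the discount factor do not enter the trace
`F_t`, so they are not recorded.) -/
structure MDP (S A : Type*) [Fintype S] where
  /-- `prob s a s'` is `p(s' | s, a)`. -/
  prob : S → A → S → ℝ
  prob_nonneg : ∀ s a s', 0 ≤ prob s a s'
  prob_sum : ∀ s a, ∑ s', prob s a s' = 1

/-- A stationary randomized policy; `prob s a` is the probability of action `a` in state `s`. -/
structure Policy (S A : Type*) [Fintype A] where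
  /-- `prob s a` is `μ(a | s)`. -/
  prob : S → A → ℝ
  prob_nonneg : ∀ s a, 0 ≤ prob s a
  prob_sum : ∀ s, ∑ a, prob s a = 1

section

variable {S A Ω : Type*} [Fintype S] [Fintype A]

/-- The state transition matrix `P_μ` induced by a policy. -/
def MDP.transitionMatrix (M : MDP S A) (μ : Policy S A) : Matrix S S ℝ :=
  Matrix.of fun s s' => ∑ a, μ.prob s a * M.prob s a s'

/-- `d` is a stationary distribution of the state chain induced by `μ`. -/
structure IsStationaryDistribution (M : MDP S A) (μ : Policy S A) (d : S → ℝ) : Prop where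
  nonneg : ∀ s, 0 ≤ d s
  sum_eq_one : ∑ s, d s = 1
  stationary : Matrix.vecMul d (M.transitionMatrix μ) = d

/-- The importance sampling ratio `ρ(s, a) = π(a | s) / μ(a | s)`. -/
def importanceRatio (μ π : Policy S A) (s : S) (a : A) : ℝ :=
  π.prob s a / μ.prob s a

/-- The states `X t` and actions `U t` on the probability space `(Ω, P)` are generated by the
behavior policy `μ`: `U t ∼ μ(· | X t)` and `X (t+1) ∼ p(· | X t, U t)`, each draw being
conditionally independent of the earlier history. This is expressed by the finite-dimensional laws
(the law of the initial state `X 0` is arbitrary). -/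
structure IsTrajectory [MeasurableSpace Ω] (P : Measure Ω) (M : MDP S A) (μ : Policy S A)
    (X : ℕ → Ω → S) (U : ℕ → Ω → A) : Prop where
  measurable_state : ∀ t s, MeasurableSet {ω | X t ω = s}
  measurable_action : ∀ t a, MeasurableSet {ω | U t ω = a}
  law : ∀ (t : ℕ) (s : ℕ → S) (a : ℕ → A),
    P.real {ω | ∀ i ≤ t, X i ω = s i ∧ U i ω = a i} =
      P.real {ω | X 0 ω = s 0} *
        (∏ i ∈ Finset.range t, μ.prob (s i) (a i) * M.prob (s i) (a i) (s (i + 1))) *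
        μ.prob (s t) (a t)

/-- The trace `F_0 = 1`, `F_{t+1} = β ρ_t F_t + 1`, where `ρ_t = π(a_t | s_t) / μ(a_t | s_t)`. -/
def emphaticTrace (μ π : Policy S A) (β : ℝ) (X : ℕ → Ω → S) (U : ℕ → Ω → A) : ℕ → Ω → ℝ
  | 0 => fun _ => 1
  | t + 1 => fun ω => β * importanceRatio μ π (X t ω) (U t ω) * emphaticTrace μ π β X U t ω + 1

/-- `Var[F_t | S_t = s]`: the variance of the trace at time `t` under the conditional probability
given the event `S_t = s`. (At each time the trace takes only finitely many values, so it has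
moments of all orders.) -/
def condTraceVariance [MeasurableSpace Ω] (P : Measure Ω) (μ π : Policy S A) (β : ℝ)
    (X : ℕ → Ω → S) (U : ℕ → Ω → A) (t : ℕ) (s : S) : ℝ :=
  variance (emphaticTrace μ π β X U t) (ProbabilityTheory.cond P {ω | X t ω = s})

/-- The mismatch matrix, with entry `∑ a, p(s' | s, a) π(a | s)² / μ(a | s)` in row `s` and
column `s'`. (If `μ(a | s) = 0 = π(a | s)`, the summand is `0`.) -/
def mismatchMatrix (M : MDP S A) (μ π : Policy S A) : Matrix S S ℝ :=
  Matrix.of fun s s' => ∑ a, M.prob s a s' * (π.prob s a ^ 2 / μ.prob s a)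

/-- The largest magnitude of the complex eigenvalues of a real square matrix. -/
def eigenvalueRadius [DecidableEq S] (B : Matrix S S ℝ) : ℝ :=
  (spectralRadius ℂ (B.map (fun x : ℝ => (x : ℂ)))).toReal

/-- The matrix norm induced by the `ℓ_∞` norm (maximum absolute row sum). -/
def inftyNorm (B : Matrix S S ℝ) : ℝ :=
  letI : NormedAddCommGroup (Matrix S S ℝ) := Matrix.linftyOpNormedAddCommGroup
  ‖B‖

end

end

/-! Everything reduces to the unnormalised moments `g_t(s) = E[F_t; s_t = s]` and `h_t(s) = E[F_t²;
s_t = s]`. Given `s_t`, the action is independent of `F_t`, and `μρ = π`, `μρ² = π²/μ`; hence, with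
`p_t(s) = Pr(s_t = s)`, `g_{t+1} = β g_t P_π + p_{t+1}` and `h_{t+1} = β² h_t P̃ + 2 g_{t+1} -
p_{t+1}` (`firstMoment_succ`, `secondMoment_succ`). An affine recursion converges when its forcing
term does and the powers of its matrix are summable (`tendsto_affine_recursion`). Summability comes
from stochasticity of `P_π` and `β < 1` in the first case, from Gelfand's formula and `β² α < 1` in
the second. The variances then tend to `h/d - (g/d)²`.

For the bound, sum the limit equations over states, with `N = ‖P̃‖_∞`: `∑ g = 1/(1-β)` and `∑ h ≤
(2/(1-β) - 1)/(1 - β² N)`. Since `Var F ≤ E(F-1)²`, the weighted variance is at most `∑ (h - 2g +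
d)`. -/

/-! ### Affine recursions and summability of matrix powers. -/

/-- Tannery's theorem for an affine recursion of row vectors with convergent forcing term. -/
theorem tendsto_affine_recursion {S : Type*} [Fintype S] [DecidableEq S]
    (B : Matrix S S ℝ) (hB : ∀ i k, Summable fun n : ℕ => |(B ^ n) i k|)
    (x b : ℕ → S → ℝ) (c : S → ℝ)
    (hx : ∀ t k, x (t + 1) k = ∑ i, x t i * B i k + b t k)
    (hb : ∀ k, Tendsto (fun t => b t k) atTop (𝓝 (c k))) :
    ∃ y : S → ℝ, (∀ k, Tendsto (fun t => x t k) atTop (𝓝 (y k))) ∧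
      ∀ k, y k = ∑ i, y i * B i k + c k := by
  -- Unrolled recursion `x_t = x_0 B^t + ∑_{j<t} b_{t-1-j} B^j`; the natural subtraction never
  -- truncates for `j < t`.
  have hexp : ∀ t k, x t k = ∑ i, x 0 i * (B ^ t) i k
      + ∑ j ∈ Finset.range t, ∑ i, b (t - 1 - j) i * (B ^ j) i k := by
    intro t
    induction t with
    | zero => intro k; simp [Matrix.one_apply]
    | succ t ih =>
      intro k
      rw [hx, Finset.sum_range_succ']
      have e1 : ∀ (v : S → ℝ) (n : ℕ), ∑ i, (∑ l, v l * (B ^ n) l i) * B i k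
          = ∑ l, v l * (B ^ (n + 1)) l k := by
        intro v n
        simp only [Finset.sum_mul, pow_succ, Matrix.mul_apply, Finset.mul_sum]
        rw [Finset.sum_comm]
        simp only [mul_assoc]
      simp only [ih, add_mul, Finset.sum_add_distrib, e1]
      rw [add_assoc]
      congr 1
      congr 1
      · simp only [Finset.sum_mul]
        rw [Finset.sum_comm]
        refine Finset.sum_congr rfl fun j _ => ?_
        have : t + 1 - 1 - (j + 1) = t - 1 - j := by omega
        rw [this, ← e1]
        simp only [Finset.sum_mul]
      · simp [Matrix.one_apply]
  have hbd : ∃ K : ℝ, 0 ≤ K ∧ ∀ t i, |b t i| ≤ K := by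
    have h1 : ∀ i, ∃ K : ℝ, ∀ t, |b t i| ≤ K := by
      intro i
      obtain ⟨K, hK⟩ := (hb i).abs.bddAbove_range
      exact ⟨K, fun t => hK ⟨t, rfl⟩⟩
    choose K hK using h1
    refine ⟨∑ i, |K i|, by positivity, fun t i => (hK i t).trans ((le_abs_self _).trans ?_)⟩
    exact Finset.single_le_sum (f := fun i => |K i|) (fun _ _ => abs_nonneg _) (Finset.mem_univ i)
  obtain ⟨K, hK0, hK⟩ := hbd
  have hlim : ∀ k, Tendsto (fun t => x t k) atTop (𝓝 (∑' j, ∑ i, c i * (B ^ j) i k)) := by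
    intro k
    have hz : Tendsto (fun t => ∑ i, x 0 i * (B ^ t) i k) atTop (𝓝 0) := by
      have : Tendsto (fun t => ∑ i, x 0 i * (B ^ t) i k) atTop (𝓝 (∑ i, x 0 i * 0)) :=
        tendsto_finsetSum _ fun i _ => (((hB i k).of_abs).tendsto_atTop_zero).const_mul _
      simpa using this
    -- Extending the convolution by zero to all `j` puts it in the form required by dominated
    -- convergence.
    have hs : Tendsto (fun t => ∑' j, if j < t then ∑ i, b (t - 1 - j) i * (B ^ j) i k else 0)
        atTop (𝓝 (∑' j, ∑ i, c i * (B ^ j) i k)) := by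
      refine tendsto_tsum_of_dominated_convergence
        (bound := fun j => ∑ i, K * |(B ^ j) i k|) ?_ ?_ ?_
      · exact summable_sum fun i _ => (hB i k).mul_left K
      · intro j
        have : Tendsto (fun t => ∑ i, b (t - 1 - j) i * (B ^ j) i k) atTop
            (𝓝 (∑ i, c i * (B ^ j) i k)) := by
          refine tendsto_finsetSum _ fun i _ => Tendsto.mul_const _ ?_
          refine (hb i).comp ?_
          simp only [Nat.sub_sub]
          exact tendsto_sub_atTop_nat _
        refine this.congr' ?_
        filter_upwards [eventually_gt_atTop j] with t ht
        simp [ht]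
      · refine Eventually.of_forall fun t j => ?_
        split_ifs
        · rw [Real.norm_eq_abs]
          refine (Finset.abs_sum_le_sum_abs _ _).trans (Finset.sum_le_sum fun i _ => ?_)
          rw [abs_mul]
          exact mul_le_mul_of_nonneg_right (hK _ _) (abs_nonneg _)
        · simp only [norm_zero]; positivity
    have := hz.add hs
    rw [zero_add] at this
    refine this.congr fun t => ?_
    rw [hexp t k]
    congr 1
    rw [tsum_eq_sum (s := Finset.range t)]
    · exact Finset.sum_congr rfl fun j hj => by simp [Finset.mem_range.1 hj]
    · intro j hj
      simp [Finset.mem_range.not.1 hj]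
  refine ⟨_, hlim, fun k => ?_⟩
  -- The fixed-point equation is the limit of the recursion itself, so `1 - B` need not be inverted.
  refine tendsto_nhds_unique ((hlim k).comp (tendsto_add_atTop_nat 1)) ?_
  have : Tendsto (fun t => ∑ i, x t i * B i k + b t k) atTop
      (𝓝 (∑ i, (∑' j, ∑ l, c l * (B ^ j) l i) * B i k + c k)) :=
    (tendsto_finsetSum _ fun i _ => (hlim i).mul_const _).add (hb k)
  exact this.congr fun t => (hx t k).symm

/-- An entry of a real matrix is bounded by the norm of its complexification. -/
theorem abs_entry_le_linfty {S : Type*} [Fintype S] (B : Matrix S S ℝ) (i k : S) :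
    letI : NormedAddCommGroup (Matrix S S ℂ) := Matrix.linftyOpNormedAddCommGroup
    |B i k| ≤ ‖B.map (fun x : ℝ => (x : ℂ))‖ := by
  let _ : NormedAddCommGroup (Matrix S S ℂ) := Matrix.linftyOpNormedAddCommGroup
  rw [Matrix.linfty_opNorm_def]
  have h1 : |B i k| ≤ ((∑ j, ‖B.map (fun x : ℝ => (x : ℂ)) i j‖₊ : NNReal) : ℝ) := by
    have := Finset.single_le_sum (f := fun j => ‖B.map (fun x : ℝ => (x : ℂ)) i j‖)
      (fun _ _ => norm_nonneg _) (Finset.mem_univ k)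
    simpa using this
  exact h1.trans (NNReal.coe_le_coe.2
    (Finset.le_sup (f := fun i => ∑ j, ‖B.map (fun x : ℝ => (x : ℂ)) i j‖₊) (Finset.mem_univ i)))

/-- Powers of `r • B` are summable as soon as `r` times the spectral radius of `B` is below one. -/
theorem summable_pow_of_eigenvalueRadius {S : Type*} [Fintype S] [DecidableEq S]
    (B : Matrix S S ℝ) (r : ℝ) (hr : 0 ≤ r) (h : r * eigenvalueRadius B < 1) (i k : S) :
    Summable fun n : ℕ => |((r • B) ^ n) i k| := by
  let _ : NormedRing (Matrix S S ℂ) := Matrix.linftyOpNormedRing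
  let _ : NormedAlgebra ℂ (Matrix S S ℂ) := Matrix.linftyOpNormedAlgebra
  have _ : CompleteSpace (Matrix S S ℂ) := FiniteDimensional.complete ℂ _
  set C : Matrix S S ℂ := B.map (fun x : ℝ => (x : ℂ)) with hC
  -- Finiteness ensures that `toReal` in `eigenvalueRadius` loses nothing.
  have hfin : spectralRadius ℂ C ≠ ⊤ :=
    ne_top_of_le_ne_top (by finiteness) (spectrum.spectralRadius_le_pow_nnnorm_pow_one_div ℂ C 0)
  -- Room above the spectral radius: Gelfand's formula gives `‖C ^ n‖ ≤ q ^ n` eventually, so `(r q)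
  -- ^ n` dominates.
  have hq : ∃ q : NNReal, spectralRadius ℂ C < q ∧ r * q < 1 := by
    have hcont : Tendsto (fun q : ℝ => r * q) (𝓝[>] (eigenvalueRadius B))
        (𝓝 (r * eigenvalueRadius B)) :=
      ((continuous_const.mul continuous_id).tendsto _).mono_left nhdsWithin_le_nhds
    obtain ⟨q, hq1, hq2⟩ := ((hcont.eventually_lt_const h).and self_mem_nhdsWithin).exists
    have hq0 : 0 ≤ q := ENNReal.toReal_nonneg.trans (le_of_lt hq2)
    refine ⟨q.toNNReal, (ENNReal.lt_ofReal_iff_toReal_lt hfin).2 hq2, ?_⟩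
    rwa [Real.coe_toNNReal q hq0]
  obtain ⟨q, hq1, hq2⟩ := hq
  have hev := (spectrum.pow_nnnorm_pow_one_div_tendsto_nhds_spectralRadius C).eventually_lt_const
    hq1
  have hent : ∀ n : ℕ, |((r • B) ^ n) i k| ≤ r ^ n * ‖C ^ n‖ := by
    intro n
    have hp : (B ^ n).map (fun x : ℝ => (x : ℂ)) = C ^ n :=
      (map_pow (Complex.ofRealHom.mapMatrix) B n)
    rw [smul_pow, Matrix.smul_apply, smul_eq_mul, abs_mul, abs_of_nonneg (pow_nonneg hr n)]
    refine mul_le_mul_of_nonneg_left ?_ (pow_nonneg hr n)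
    rw [← hp]
    exact abs_entry_le_linfty (B ^ n) i k
  refine summable_of_isBigO_nat
    (summable_geometric_of_lt_one (mul_nonneg hr q.coe_nonneg) hq2) ?_
  refine Asymptotics.IsBigO.of_bound 1 ?_
  filter_upwards [hev, eventually_gt_atTop 0] with n hn hn0
  have hle : ‖C ^ n‖ ≤ (q : ℝ) ^ n := by
    have h1 : ((‖C ^ n‖₊ : NNReal) : ENNReal) ≤ ((q ^ n : NNReal) : ENNReal) := by
      have := ENNReal.rpow_le_rpow hn.le (Nat.cast_nonneg (α := ℝ) n)
      rw [← ENNReal.rpow_mul, one_div_mul_cancel (by positivity), ENNReal.rpow_one,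
        ENNReal.rpow_natCast] at this
      exact_mod_cast this
    exact_mod_cast h1
  rw [Real.norm_eq_abs, abs_abs, one_mul, Real.norm_eq_abs,
    abs_of_nonneg (pow_nonneg (mul_nonneg hr q.coe_nonneg) n), mul_pow]
  exact (hent n).trans (mul_le_mul_of_nonneg_left hle (pow_nonneg hr n))

/-- Powers of a strictly substochastic multiple of a stochastic matrix are summable. -/
theorem summable_pow_of_stochastic {S : Type*} [Fintype S] [DecidableEq S]
    (B : Matrix S S ℝ) (hB0 : ∀ i k, 0 ≤ B i k) (hB1 : ∀ i, ∑ k, B i k = 1)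
    (r : ℝ) (hr : 0 ≤ r) (hr1 : r < 1) (i k : S) :
    Summable fun n : ℕ => |((r • B) ^ n) i k| := by
  have hp : ∀ n : ℕ, (∀ i k, 0 ≤ (B ^ n) i k) ∧ ∀ i, ∑ k, (B ^ n) i k = 1 := by
    intro n
    induction n with
    | zero =>
      refine ⟨fun i k => ?_, fun i => by simp [Matrix.one_apply]⟩
      rw [pow_zero, Matrix.one_apply]
      split_ifs <;> norm_num
    | succ n ih =>
      refine ⟨fun i k => ?_, fun i => ?_⟩
      · rw [pow_succ, Matrix.mul_apply]
        exact Finset.sum_nonneg fun j _ => mul_nonneg (ih.1 _ _) (hB0 _ _)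
      · simp only [pow_succ, Matrix.mul_apply]
        rw [Finset.sum_comm]
        simp only [← Finset.mul_sum, hB1, mul_one, ih.2]
  refine Summable.of_nonneg_of_le (fun _ => abs_nonneg _) (fun n => ?_)
    (summable_geometric_of_lt_one hr hr1)
  rw [smul_pow, Matrix.smul_apply, smul_eq_mul, abs_mul, abs_of_nonneg (pow_nonneg hr n),
    abs_of_nonneg ((hp n).1 i k)]
  refine mul_le_of_le_one_right (pow_nonneg hr n) ?_
  rw [← (hp n).2 i]
  exact Finset.single_le_sum (f := fun k => (B ^ n) i k) (fun k _ => (hp n).1 i k)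
    (Finset.mem_univ k)

/-- The `ℓ_∞`-induced norm bounds the row sums. -/
theorem row_sum_le_inftyNorm {S : Type*} [Fintype S] (B : Matrix S S ℝ) (i : S) :
    ∑ k, B i k ≤ inftyNorm B := by
  unfold inftyNorm
  let _ : NormedAddCommGroup (Matrix S S ℝ) := Matrix.linftyOpNormedAddCommGroup
  rw [Matrix.linfty_opNorm_def]
  have h1 : ∑ k, B i k ≤ ((∑ j, ‖B i j‖₊ : NNReal) : ℝ) := by
    push_cast
    exact Finset.sum_le_sum fun j _ => le_abs_self _
  exact h1.trans (NNReal.coe_le_coe.2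
    (Finset.le_sup (f := fun i => ∑ j, ‖B i j‖₊) (Finset.mem_univ i)))

/-! ### Functions of the history. -/

/-- The states and actions up to time `t`. -/
def history {S A Ω : Type*} (X : ℕ → Ω → S) (U : ℕ → Ω → A) (t : ℕ) (ω : Ω) :
    Fin (t + 1) → S × A :=
  fun i => (X i ω, U i ω)

/-- The random variable `f` is a function of the states and actions up to time `t`. -/
def HistoryDetermined {S A Ω : Type*} (X : ℕ → Ω → S) (U : ℕ → Ω → A) (t : ℕ) (f : Ω → ℝ) : Prop :=
  ∃ φ : (Fin (t + 1) → S × A) → ℝ, ∀ ω, f ω = φ (history X U t ω)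

theorem history_eq_iff {S A Ω : Type*} (X : ℕ → Ω → S) (U : ℕ → Ω → A) (t : ℕ) (ω : Ω)
    (h : Fin (t + 1) → S × A) (s : ℕ → S) (a : ℕ → A)
    (hs : ∀ i : Fin (t + 1), h i = (s i, a i)) :
    history X U t ω = h ↔ ∀ i ≤ t, X i ω = s i ∧ U i ω = a i := by
  constructor
  · rintro rfl i hi
    have := hs ⟨i, Nat.lt_succ_of_le hi⟩
    simpa [history] using this
  · intro hi
    funext i
    rw [hs i]
    obtain ⟨h1, h2⟩ := hi i (Nat.le_of_lt_succ i.2)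
    simp [history, h1, h2]

theorem HistoryDetermined.succ {S A Ω : Type*} {X : ℕ → Ω → S} {U : ℕ → Ω → A} {t : ℕ}
    {f : Ω → ℝ} (hf : HistoryDetermined X U t f) : HistoryDetermined X U (t + 1) f := by
  obtain ⟨φ, hφ⟩ := hf
  exact ⟨fun h => φ (fun i => h i.castSucc), fun ω => hφ ω⟩

theorem HistoryDetermined.comp {S A Ω : Type*} {X : ℕ → Ω → S} {U : ℕ → Ω → A} {t : ℕ}
    {f : Ω → ℝ} (hf : HistoryDetermined X U t f) (G : ℝ → ℝ) :
    HistoryDetermined X U t (fun ω => G (f ω)) := by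
  obtain ⟨φ, hφ⟩ := hf
  exact ⟨fun h => G (φ h), fun ω => by simp only [hφ]⟩

/-- `F_{t+1}` involves only `ρ_0, …, ρ_t`. This gain of one time step is what makes it independent
of `a_{t+1}` given `s_{t+1}`. -/
theorem historyDetermined_step {S A Ω : Type*} [Fintype A] {X : ℕ → Ω → S} {U : ℕ → Ω → A}
    (μ π : Policy S A) (β : ℝ) {t : ℕ}
    (h : HistoryDetermined X U t (emphaticTrace μ π β X U t)) :
    HistoryDetermined X U t (emphaticTrace μ π β X U (t + 1)) := by
  obtain ⟨φ, hφ⟩ := h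
  refine ⟨fun h => β * importanceRatio μ π (h (Fin.last t)).1 (h (Fin.last t)).2 * φ h + 1,
    fun ω => ?_⟩
  simp only [emphaticTrace, hφ, history, Fin.val_last]

theorem historyDetermined_emphaticTrace {S A Ω : Type*} [Fintype A] (X : ℕ → Ω → S)
    (U : ℕ → Ω → A) (μ π : Policy S A) (β : ℝ) (t : ℕ) :
    HistoryDetermined X U t (emphaticTrace μ π β X U t) := by
  induction t with
  | zero => exact ⟨fun _ => 1, fun _ => rfl⟩
  | succ t ih => exact (historyDetermined_step μ π β ih).succ

/-! ### Integrals of functions of finite-valued variables. -/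

section FiniteValued

variable {Ω H : Type*} [MeasurableSpace Ω] [Fintype H]

theorem memLp_comp_finite (P : Measure Ω) [IsFiniteMeasure P] (Z : Ω → H)
    (hZ : ∀ h, MeasurableSet {ω | Z ω = h}) (φ : H → ℝ) (p : ENNReal) :
    MemLp (fun ω => φ (Z ω)) p P := by
  let _ : MeasurableSpace H := ⊤
  have hm : Measurable Z := measurable_to_countable' hZ
  have hφ : Measurable φ := measurable_from_top
  refine MemLp.of_bound (hφ.comp hm).aestronglyMeasurable (∑ h, |φ h|)
    (Eventually.of_forall fun ω => ?_)
  exact Finset.single_le_sum (f := fun h => |φ h|) (fun _ _ => abs_nonneg _)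
    (Finset.mem_univ (Z ω))

theorem integral_eq_sum_fibers (P : Measure Ω) (Z : Ω → H)
    (hZ : ∀ h, MeasurableSet {ω | Z ω = h}) (f : Ω → ℝ) (hf : Integrable f P) :
    ∫ ω, f ω ∂P = ∑ h, ∫ ω in {ω | Z ω = h}, f ω ∂P := by
  rw [← integral_iUnion_fintype hZ]
  · have : (⋃ h, {ω | Z ω = h}) = Set.univ := by ext; simp
    rw [this, setIntegral_univ]
  · intro i j hij
    refine Set.disjoint_left.2 fun ω h1 h2 => hij ?_
    exact (show Z ω = i from h1).symm.trans h2
  · exact fun _ => hf.integrableOn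

/-- `E` need not be determined by `Z`: it will be an event about the next state and action, with `Z`
the history. -/
theorem setIntegral_comp_finite (P : Measure Ω) [IsFiniteMeasure P] (Z : Ω → H)
    (hZ : ∀ h, MeasurableSet {ω | Z ω = h}) (φ : H → ℝ) (E : Set Ω) :
    ∫ ω in E, φ (Z ω) ∂P = ∑ h, P.real ({ω | Z ω = h} ∩ E) * φ h := by
  rw [integral_eq_sum_fibers (P.restrict E) Z hZ _
    (memLp_one_iff_integrable.1 (memLp_comp_finite _ Z hZ φ 1))]
  refine Finset.sum_congr rfl fun h _ => ?_
  rw [setIntegral_congr_fun (g := fun _ => φ h) (hZ h)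
    (fun ω (hω : Z ω = h) => by simp only [hω]), setIntegral_const, smul_eq_mul,
    measureReal_restrict_apply (hZ h)]

end FiniteValued

/-! ### The Markov property. -/

section Trajectory

variable {S A Ω : Type*} [Fintype S] [Fintype A] [MeasurableSpace Ω] {P : Measure Ω}
  {M : MDP S A} {μ : Policy S A} {X : ℕ → Ω → S} {U : ℕ → Ω → A}

theorem IsTrajectory.measurableSet_pair (h : IsTrajectory P M μ X U) (t : ℕ) (y : S × A) :
    MeasurableSet {ω | (X t ω, U t ω) = y} := by
  have : {ω | (X t ω, U t ω) = y} = {ω | X t ω = y.1} ∩ {ω | U t ω = y.2} := by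
    ext ω; simp [Prod.ext_iff]
  rw [this]
  exact (h.measurable_state t _).inter (h.measurable_action t _)

theorem IsTrajectory.measurableSet_history (hT : IsTrajectory P M μ X U) (t : ℕ)
    (h : Fin (t + 1) → S × A) : MeasurableSet {ω | history X U t ω = h} := by
  have : {ω | history X U t ω = h} = ⋂ i : Fin (t + 1), {ω | (X i ω, U i ω) = h i} := by
    ext ω
    simp only [Set.mem_ofPred_eq, Set.mem_iInter, funext_iff, history]
  rw [this]
  exact MeasurableSet.iInter fun i => hT.measurableSet_pair _ _

theorem HistoryDetermined.memLp (hT : IsTrajectory P M μ X U) {t : ℕ} {f : Ω → ℝ}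
    (hf : HistoryDetermined X U t f) (Q : Measure Ω) [IsFiniteMeasure Q] (p : ENNReal) :
    MemLp f p Q := by
  obtain ⟨φ, hφ⟩ := hf
  rw [show f = fun ω => φ (history X U t ω) from funext hφ]
  classical
  exact memLp_comp_finite Q _ (hT.measurableSet_history t) φ p

theorem HistoryDetermined.integrable (hT : IsTrajectory P M μ X U) {t : ℕ} {f : Ω → ℝ}
    (hf : HistoryDetermined X U t f) (Q : Measure Ω) [IsFiniteMeasure Q] : Integrable f Q :=
  memLp_one_iff_integrable.1 (hf.memLp hT Q 1)

theorem IsTrajectory.real_history_succ (hT : IsTrajectory P M μ X U) (t : ℕ)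
    (h : Fin (t + 1) → S × A) (y : S × A) :
    P.real ({ω | history X U t ω = h} ∩ {ω | (X (t + 1) ω, U (t + 1) ω) = y}) =
      P.real {ω | history X U t ω = h} *
        (M.prob (h (Fin.last t)).1 (h (Fin.last t)).2 y.1 * μ.prob y.1 y.2) := by
  -- The law is stated for infinite sequences, so the history is padded by `y` after time `t`.
  let s : ℕ → S := fun i => if hi : i < t + 1 then (h ⟨i, hi⟩).1 else y.1
  let a : ℕ → A := fun i => if hi : i < t + 1 then (h ⟨i, hi⟩).2 else y.2
  have hs : ∀ i : Fin (t + 1), h i = (s i, a i) := by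
    intro i
    simp only [s, a, dif_pos i.2]
  have hy : y = (s (t + 1), a (t + 1)) := by simp [s, a]
  have e1 : {ω | history X U t ω = h} = {ω | ∀ i ≤ t, X i ω = s i ∧ U i ω = a i} := by
    ext ω
    exact history_eq_iff X U t ω h s a hs
  have e2 : {ω | history X U t ω = h} ∩ {ω | (X (t + 1) ω, U (t + 1) ω) = y} =
      {ω | ∀ i ≤ t + 1, X i ω = s i ∧ U i ω = a i} := by
    rw [e1, hy]
    ext ω
    simp only [Set.mem_inter_iff, Set.mem_ofPred_eq, Prod.mk.injEq]
    constructor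
    · rintro ⟨h1, h2⟩ i hi
      rcases Nat.le_succ_iff.1 hi with h3 | rfl
      · exact h1 i h3
      · exact h2
    · exact fun h1 => ⟨fun i hi => h1 i (hi.trans (Nat.le_succ t)), h1 _ le_rfl⟩
  rw [e2, e1, hT.law, hT.law, Finset.prod_range_succ, hs (Fin.last t), hy]
  simp only [Fin.val_last]
  ring

variable [IsProbabilityMeasure P]

/-- The Markov property, integrated against functions of the history. -/
theorem IsTrajectory.setIntegral_pair_succ (hT : IsTrajectory P M μ X U) {t : ℕ} {f : Ω → ℝ}
    (hf : HistoryDetermined X U t f) (s : S) (a : A) :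
    ∫ ω in {ω | (X (t + 1) ω, U (t + 1) ω) = (s, a)}, f ω ∂P =
      (∫ ω, f ω * M.prob (X t ω) (U t ω) s ∂P) * μ.prob s a := by
  obtain ⟨φ, hφ⟩ := hf
  simp only [hφ]
  rw [setIntegral_comp_finite P _ (hT.measurableSet_history t)]
  have := setIntegral_comp_finite P _ (hT.measurableSet_history t)
    (fun h => φ h * M.prob (h (Fin.last t)).1 (h (Fin.last t)).2 s) Set.univ
  simp only [Set.inter_univ, setIntegral_univ] at this
  refine Eq.trans ?_ (congrArg (· * μ.prob s a) this.symm)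
  simp only [Finset.sum_mul]
  refine Finset.sum_congr rfl fun h _ => ?_
  rw [hT.real_history_succ t h (s, a)]
  ring

theorem IsTrajectory.setIntegral_state_eq_sum (hT : IsTrajectory P M μ X U) {t u : ℕ} {f : Ω → ℝ}
    (hf : HistoryDetermined X U u f) (s : S) :
    ∫ ω in {ω | X t ω = s}, f ω ∂P =
      ∑ a, ∫ ω in {ω | (X t ω, U t ω) = (s, a)}, f ω ∂P := by
  rw [integral_eq_sum_fibers _ (U t) (hT.measurable_action t) f (hf.integrable hT _)]
  refine Finset.sum_congr rfl fun a _ => ?_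
  rw [Measure.restrict_restrict (hT.measurable_action t a)]
  congr 2
  ext ω
  simp [and_comm]

theorem IsTrajectory.setIntegral_state_succ (hT : IsTrajectory P M μ X U) {t : ℕ} {f : Ω → ℝ}
    (hf : HistoryDetermined X U t f) (s : S) :
    ∫ ω in {ω | X (t + 1) ω = s}, f ω ∂P = ∫ ω, f ω * M.prob (X t ω) (U t ω) s ∂P := by
  rw [hT.setIntegral_state_eq_sum hf]
  simp only [hT.setIntegral_pair_succ hf]
  rw [← Finset.mul_sum, μ.prob_sum, mul_one]

theorem IsTrajectory.setIntegral_state_succ_eq_sum (hT : IsTrajectory P M μ X U) {t : ℕ}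
    {f : Ω → ℝ} (hf : HistoryDetermined X U t f) (s : S) :
    ∫ ω in {ω | X (t + 1) ω = s}, f ω ∂P =
      ∑ r, ∑ a, (∫ ω in {ω | (X t ω, U t ω) = (r, a)}, f ω ∂P) * M.prob r a s := by
  have hdet : HistoryDetermined X U t (fun ω => f ω * M.prob (X t ω) (U t ω) s) := by
    obtain ⟨φ, hφ⟩ := hf
    refine ⟨fun h => φ h * M.prob (h (Fin.last t)).1 (h (Fin.last t)).2 s, fun ω => ?_⟩
    simp only [hφ, history, Fin.val_last]
  rw [hT.setIntegral_state_succ hf,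
    integral_eq_sum_fibers P _ (hT.measurableSet_pair t) _ (hdet.integrable hT P),
    Fintype.sum_prod_type]
  refine Finset.sum_congr rfl fun r _ => Finset.sum_congr rfl fun a _ => ?_
  rw [← integral_mul_const]
  refine setIntegral_congr_fun (hT.measurableSet_pair t _) fun ω hω => ?_
  obtain ⟨h1, h2⟩ := Prod.mk.inj (show (X t ω, U t ω) = (r, a) from hω)
  simp only [h1, h2]

/-- Given the current state, the action is independent of the trace. -/
theorem IsTrajectory.setIntegral_trace_pair (hT : IsTrajectory P M μ X U) (π : Policy S A)
    (β : ℝ) (G : ℝ → ℝ) (t : ℕ) (s : S) (a : A) :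
    ∫ ω in {ω | (X t ω, U t ω) = (s, a)}, G (emphaticTrace μ π β X U t ω) ∂P =
      (∫ ω in {ω | X t ω = s}, G (emphaticTrace μ π β X U t ω) ∂P) * μ.prob s a := by
  cases t with
  | zero =>
    -- `F_0` is constant, so only the joint law of the first state and action matters.
    have h0 := hT.law 0 (fun _ => s) (fun _ => a)
    simp only [Nat.le_zero, forall_eq, Finset.range_zero, Finset.prod_empty, mul_one] at h0
    simp only [emphaticTrace, setIntegral_const, smul_eq_mul, Prod.mk.injEq, h0]
    ring
  | succ t =>
    have hd := (historyDetermined_step μ π β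
      (historyDetermined_emphaticTrace X U μ π β t)).comp G
    rw [hT.setIntegral_pair_succ hd, hT.setIntegral_state_succ hd]

/-- The moments of the trace on the events `X t = s` after one step. -/
theorem IsTrajectory.setIntegral_trace_succ (hT : IsTrajectory P M μ X U) (π : Policy S A)
    (β : ℝ) (G : ℝ → ℝ) (t : ℕ) (s : S) :
    ∫ ω in {ω | X (t + 1) ω = s}, G (emphaticTrace μ π β X U (t + 1) ω) ∂P =
      ∑ r, ∑ a, (∫ ω in {ω | X t ω = r},
        G (β * importanceRatio μ π r a * emphaticTrace μ π β X U t ω + 1) ∂P) *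
          μ.prob r a * M.prob r a s := by
  rw [hT.setIntegral_state_succ_eq_sum ((historyDetermined_step μ π β
      (historyDetermined_emphaticTrace X U μ π β t)).comp G)]
  refine Finset.sum_congr rfl fun r _ => Finset.sum_congr rfl fun a _ => ?_
  rw [← hT.setIntegral_trace_pair π β
    (fun x => G (β * importanceRatio μ π r a * x + 1)) t r a]
  congr 1
  refine setIntegral_congr_fun (hT.measurableSet_pair t _) fun ω hω => ?_
  obtain ⟨h1, h2⟩ := Prod.mk.inj (show (X t ω, U t ω) = (r, a) from hω)
  simp only [emphaticTrace, h1, h2]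

end Trajectory

/-! ### Moment recursions and conditional variance. -/

/-- No condition on `P E` is needed: if it is `0` or `⊤`, both sides are zero by convention. -/
theorem integral_cond_eq {Ω : Type*} [MeasurableSpace Ω] (P : Measure Ω) (E : Set Ω) (f : Ω → ℝ) :
    ∫ ω, f ω ∂(ProbabilityTheory.cond P E) = (∫ ω in E, f ω ∂P) / P.real E := by
  rw [ProbabilityTheory.cond, integral_smul_measure, smul_eq_mul, ENNReal.toReal_inv,
    Measure.real, div_eq_inv_mul]

section Moments

variable {S A Ω : Type*} [Fintype S] [Fintype A] [MeasurableSpace Ω] {P : Measure Ω}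
  {M : MDP S A} {μ π : Policy S A} {X : ℕ → Ω → S} {U : ℕ → Ω → A} [IsProbabilityMeasure P]

theorem IsTrajectory.real_state_succ (hT : IsTrajectory P M μ X U) (t : ℕ) (s : S) :
    P.real {ω | X (t + 1) ω = s} =
      ∑ r, ∑ a, P.real {ω | X t ω = r} * μ.prob r a * M.prob r a s := by
  -- With `G = 1` the trace disappears; the target policy and `β` are dummies.
  simpa using hT.setIntegral_trace_succ μ 0 (fun _ => 1) t s

theorem IsTrajectory.firstMoment_succ (hT : IsTrajectory P M μ X U)
    (hcov : ∀ s a, μ.prob s a = 0 → π.prob s a = 0) (β : ℝ) (t : ℕ) (s : S) :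
    ∫ ω in {ω | X (t + 1) ω = s}, emphaticTrace μ π β X U (t + 1) ω ∂P =
      ∑ r, (∫ ω in {ω | X t ω = r}, emphaticTrace μ π β X U t ω ∂P) *
        (β • M.transitionMatrix π) r s + P.real {ω | X (t + 1) ω = s} := by
  have hF := (historyDetermined_emphaticTrace X U μ π β t).integrable hT
  rw [hT.setIntegral_trace_succ π β (fun x => x) t s, hT.real_state_succ,
    ← Finset.sum_add_distrib]
  refine Finset.sum_congr rfl fun r _ => ?_
  rw [Matrix.smul_apply, smul_eq_mul, MDP.transitionMatrix, Matrix.of_apply, Finset.mul_sum,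
    Finset.mul_sum, ← Finset.sum_add_distrib]
  refine Finset.sum_congr rfl fun a _ => ?_
  have hρ : importanceRatio μ π r a * μ.prob r a = π.prob r a :=
    div_mul_cancel_of_imp (hcov r a)
  rw [integral_add ((hF _).const_mul _) (integrable_const _), integral_const_mul]
  simp only [integral_const, measureReal_restrict_apply_univ, smul_eq_mul, mul_one]
  rw [← hρ]
  ring

/-- Since `F_{t+1} = βρ_t F_t + 1`, one has `F_{t+1}² = (βρ_t F_t)² + 2 F_{t+1} - 1`. The forcing
term thus contains only the first moment and the state law, whose limits are already known. -/
theorem IsTrajectory.secondMoment_succ (hT : IsTrajectory P M μ X U)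
    (hcov : ∀ s a, μ.prob s a = 0 → π.prob s a = 0) (β : ℝ) (t : ℕ) (s : S) :
    ∫ ω in {ω | X (t + 1) ω = s}, emphaticTrace μ π β X U (t + 1) ω ^ 2 ∂P =
      ∑ r, (∫ ω in {ω | X t ω = r}, emphaticTrace μ π β X U t ω ^ 2 ∂P) *
        (β ^ 2 • mismatchMatrix M μ π) r s +
      (2 * ∫ ω in {ω | X (t + 1) ω = s}, emphaticTrace μ π β X U (t + 1) ω ∂P
        - P.real {ω | X (t + 1) ω = s}) := by
  have hd := historyDetermined_emphaticTrace X U μ π β t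
  have hF := hd.integrable hT
  have hF2 := (hd.comp (fun x => x ^ 2)).integrable hT
  rw [hT.firstMoment_succ hcov, hT.setIntegral_trace_succ π β (fun x => x ^ 2) t s]
  suffices h : ∑ r, ∑ a, (∫ ω in {ω | X t ω = r},
        (β * importanceRatio μ π r a * emphaticTrace μ π β X U t ω + 1) ^ 2 ∂P) *
          μ.prob r a * M.prob r a s =
      ∑ r, ((∫ ω in {ω | X t ω = r}, emphaticTrace μ π β X U t ω ^ 2 ∂P) *
        (β ^ 2 • mismatchMatrix M μ π) r s + 2 *
        ((∫ ω in {ω | X t ω = r}, emphaticTrace μ π β X U t ω ∂P) *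
        (β • M.transitionMatrix π) r s) +
        ∑ a, P.real {ω | X t ω = r} * μ.prob r a * M.prob r a s) by
    rw [h, Finset.sum_add_distrib, Finset.sum_add_distrib, ← Finset.mul_sum,
      ← hT.real_state_succ]
    ring
  refine Finset.sum_congr rfl fun r _ => ?_
  rw [Matrix.smul_apply, Matrix.smul_apply, smul_eq_mul, smul_eq_mul, MDP.transitionMatrix,
    mismatchMatrix, Matrix.of_apply, Matrix.of_apply]
  simp only [Finset.mul_sum]
  rw [← Finset.sum_add_distrib, ← Finset.sum_add_distrib]
  refine Finset.sum_congr rfl fun a _ => ?_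
  have hρ : importanceRatio μ π r a * μ.prob r a = π.prob r a :=
    div_mul_cancel_of_imp (hcov r a)
  have hρ2 : π.prob r a ^ 2 / μ.prob r a = importanceRatio μ π r a * π.prob r a := by
    rw [importanceRatio]; ring
  set ρ := importanceRatio μ π r a
  have hsq : ∀ ω, (β * ρ * emphaticTrace μ π β X U t ω + 1) ^ 2 =
      (β * ρ) ^ 2 * emphaticTrace μ π β X U t ω ^ 2 +
        2 * (β * ρ) * emphaticTrace μ π β X U t ω + 1 := fun ω => by ring
  simp only [hsq]
  have hadd : Integrable (fun ω => (β * ρ) ^ 2 * emphaticTrace μ π β X U t ω ^ 2 +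
      2 * (β * ρ) * emphaticTrace μ π β X U t ω) (P.restrict {ω | X t ω = r}) :=
    ((hF2 _).const_mul _).add ((hF _).const_mul _)
  rw [integral_add hadd (integrable_const _),
    integral_add ((hF2 _).const_mul _) ((hF _).const_mul _), integral_const_mul,
    integral_const_mul]
  simp only [integral_const, measureReal_restrict_apply_univ, smul_eq_mul, mul_one]
  rw [hρ2, ← hρ]
  ring

theorem IsTrajectory.condTraceVariance_eq (hT : IsTrajectory P M μ X U) (β : ℝ) (t : ℕ) (s : S)
    (hp : P.real {ω | X t ω = s} ≠ 0) :
    condTraceVariance P μ π β X U t s =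
      (∫ ω in {ω | X t ω = s}, emphaticTrace μ π β X U t ω ^ 2 ∂P) / P.real {ω | X t ω = s} -
      ((∫ ω in {ω | X t ω = s}, emphaticTrace μ π β X U t ω ∂P) / P.real {ω | X t ω = s}) ^ 2 := by
  have hP0 : P {ω | X t ω = s} ≠ 0 := fun h => hp (by rw [Measure.real, h, ENNReal.toReal_zero])
  have := cond_isProbabilityMeasure hP0
  have hL : MemLp (emphaticTrace μ π β X U t) 2 (ProbabilityTheory.cond P {ω | X t ω = s}) :=
    (historyDetermined_emphaticTrace X U μ π β t).memLp hT _ 2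
  rw [condTraceVariance, variance_eq_sub hL, integral_cond_eq, integral_cond_eq]
  rfl

/-- The Cauchy–Schwarz inequality on the event `X t = s`. -/
theorem IsTrajectory.sq_firstMoment_le (hT : IsTrajectory P M μ X U) (β : ℝ) (t : ℕ) (s : S) :
    (∫ ω in {ω | X t ω = s}, emphaticTrace μ π β X U t ω ∂P) ^ 2 ≤
      (∫ ω in {ω | X t ω = s}, emphaticTrace μ π β X U t ω ^ 2 ∂P) * P.real {ω | X t ω = s} := by
  by_cases hp : P.real {ω | X t ω = s} = 0
  · have h0 : P.restrict {ω | X t ω = s} = 0 := by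
      rw [Measure.restrict_eq_zero]
      exact (measureReal_eq_zero_iff (by finiteness)).1 hp
    simp [h0]
  · have hv := variance_nonneg (emphaticTrace μ π β X U t)
      (ProbabilityTheory.cond P {ω | X t ω = s})
    have hpos : 0 < P.real {ω | X t ω = s} := lt_of_le_of_ne measureReal_nonneg (Ne.symm hp)
    have he := hT.condTraceVariance_eq (π := π) β t s hp
    rw [condTraceVariance] at he
    rw [he, sub_nonneg, div_pow, div_le_div_iff₀ (pow_pos hpos 2) hpos] at hv
    nlinarith

end Moments

/-! ### The bound on the limit and the conclusion. -/

theorem MDP.transitionMatrix_nonneg {S A : Type*} [Fintype S] [Fintype A] (M : MDP S A)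
    (π : Policy S A) (i k : S) : 0 ≤ M.transitionMatrix π i k :=
  Finset.sum_nonneg fun _ _ => mul_nonneg (π.prob_nonneg _ _) (M.prob_nonneg _ _ _)

theorem MDP.transitionMatrix_row_sum {S A : Type*} [Fintype S] [Fintype A] (M : MDP S A)
    (π : Policy S A) (i : S) : ∑ k, M.transitionMatrix π i k = 1 := by
  simp only [MDP.transitionMatrix, Matrix.of_apply]
  rw [Finset.sum_comm]
  simp only [← Finset.mul_sum, M.prob_sum, mul_one, π.prob_sum]

theorem sq_mul_lt_one_of_lt_one_div_sqrt {β α : ℝ} (hβ0 : 0 ≤ β) (hα : 0 ≤ α)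
    (h : β < 1 / √α) : β ^ 2 * α < 1 := by
  rcases hα.eq_or_lt with rfl | hα
  -- At `α = 0` the convention `1 / 0 = 0` makes the hypothesis useless, but the conclusion is
  -- trivial.
  · simp
  · have h1 : β * √α < 1 := (lt_div_iff₀ (Real.sqrt_pos.2 hα)).1 h
    have h2 : (β * √α) ^ 2 < 1 := pow_lt_one₀ (by positivity) h1 two_ne_zero
    rwa [mul_pow, Real.sq_sqrt hα.le] at h2

/-- Only the limit equations, signs and Cauchy–Schwarz enter, so no probability space is needed. -/
theorem sum_variance_le_of_moment_equations {S : Type*} [Fintype S] (T B : Matrix S S ℝ)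
    (d g h : S → ℝ) (β N : ℝ) (hβ1 : β < 1)
    (hT : ∀ i, ∑ k, T i k = 1) (hB : ∀ i, ∑ k, B i k ≤ N)
    (hd0 : ∀ s, 0 ≤ d s) (hd1 : ∑ s, d s = 1) (hh0 : ∀ s, 0 ≤ h s)
    (hg : ∀ k, g k = ∑ i, g i * (β • T) i k + d k)
    (hh : ∀ k, h k = ∑ i, h i * (β ^ 2 • B) i k + (2 * g k - d k))
    (hgh : ∀ s, g s ^ 2 ≤ h s * d s) (hN : β ^ 2 * N < 1) :
    ∑ s, d s * (h s / d s - (g s / d s) ^ 2) ≤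
      β ^ 2 / (1 - β) * (2 + (1 + β) * N / (1 - β ^ 2 * N)) := by
  -- This is `Var F ≤ E(F-1)²` weighted by `d`; the discarded term is `(g - d)²/d`. Where `d = 0`
  -- the left side vanishes, and Cauchy–Schwarz forces `g = 0`.
  have hterm : ∀ s, d s * (h s / d s - (g s / d s) ^ 2) ≤ h s - 2 * g s + d s := by
    intro s
    rcases (hd0 s).eq_or_lt with hs | hs
    · have hg0 : g s = 0 := by
        have := hgh s
        rw [← hs, mul_zero] at this
        exact pow_eq_zero_iff two_ne_zero |>.1 (le_antisymm this (sq_nonneg _))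
      rw [← hs, hg0]
      simpa using hh0 s
    · have e : d s * (h s / d s - (g s / d s) ^ 2) = h s - 2 * g s + d s
          - (g s - d s) ^ 2 / d s := by
        field_simp
        ring
      rw [e]
      linarith [div_nonneg (sq_nonneg (g s - d s)) hs.le]
  have hG : ∑ s, g s = β * ∑ s, g s + 1 := by
    conv_lhs => rw [Finset.sum_congr rfl fun k _ => hg k]
    rw [Finset.sum_add_distrib, hd1, Finset.sum_comm, Finset.mul_sum]
    congr 1
    refine Finset.sum_congr rfl fun i _ => ?_
    rw [← Finset.mul_sum]
    simp only [Matrix.smul_apply, smul_eq_mul]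
    rw [← Finset.mul_sum, hT]
    ring
  have hH : ∑ s, h s ≤ β ^ 2 * N * ∑ s, h s + (2 * ∑ s, g s - 1) := by
    conv_lhs => rw [Finset.sum_congr rfl fun k _ => hh k]
    rw [Finset.sum_add_distrib, Finset.sum_sub_distrib, ← Finset.mul_sum, hd1, Finset.sum_comm,
      Finset.mul_sum _ _ (β ^ 2 * N)]
    gcongr with i
    rw [← Finset.mul_sum]
    simp only [Matrix.smul_apply, smul_eq_mul]
    rw [← Finset.mul_sum]
    calc h i * (β ^ 2 * ∑ k, B i k) ≤ h i * (β ^ 2 * N) :=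
          mul_le_mul_of_nonneg_left (mul_le_mul_of_nonneg_left (hB i) (sq_nonneg β)) (hh0 i)
      _ = β ^ 2 * N * h i := mul_comm _ _
  have hb : 0 < 1 - β := by linarith
  have hn : 0 < 1 - β ^ 2 * N := by linarith
  have hG' : ∑ s, g s = 1 / (1 - β) := by
    rw [eq_div_iff hb.ne']
    linarith
  have hH' : ∑ s, h s ≤ (2 * (1 / (1 - β)) - 1) / (1 - β ^ 2 * N) := by
    rw [le_div_iff₀ hn, ← hG']
    linarith
  calc ∑ s, d s * (h s / d s - (g s / d s) ^ 2) ≤ ∑ s, (h s - 2 * g s + d s) :=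
        Finset.sum_le_sum fun s _ => hterm s
    _ = ∑ s, h s - 2 * (1 / (1 - β)) + 1 := by
        rw [Finset.sum_add_distrib, Finset.sum_sub_distrib, ← Finset.mul_sum, hd1, hG']
    _ ≤ (2 * (1 / (1 - β)) - 1) / (1 - β ^ 2 * N) - 2 * (1 / (1 - β)) + 1 := by linarith
    _ = β ^ 2 / (1 - β) * ((1 + β) * N / (1 - β ^ 2 * N)) := by
        field_simp
        ring
    -- The summand `2` is pure slack.
    _ ≤ β ^ 2 / (1 - β) * (2 + (1 + β) * N / (1 - β ^ 2 * N)) := by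
        have : 0 ≤ β ^ 2 / (1 - β) := by positivity
        exact mul_le_mul_of_nonneg_left (by linarith) this

theorem proposition1 {S A Ω : Type*} [Fintype S] [DecidableEq S] [Fintype A]
    [MeasurableSpace Ω] (P : Measure Ω) [IsProbabilityMeasure P]
    (M : MDP S A) (μ π : Policy S A)
    (hcov : ∀ s a, μ.prob s a = 0 → π.prob s a = 0)
    (d : S → ℝ) (hd : IsStationaryDistribution M μ d)
    (X : ℕ → Ω → S) (U : ℕ → Ω → A) (hXU : IsTrajectory P M μ X U)
    (hlim : ∀ s, Tendsto (fun t => P.real {ω | X t ω = s}) atTop (𝓝 (d s)))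
    (β : ℝ) (hβ0 : 0 ≤ β) (hβ1 : β < 1)
    (hβ : β < 1 / √(eigenvalueRadius (mismatchMatrix M μ π))) :
    ∃ v : S → ℝ,
      (∀ s, 0 < d s →
        Tendsto (fun t => condTraceVariance P μ π β X U t s) atTop (𝓝 (v s))) ∧
      (β ^ 2 * inftyNorm (mismatchMatrix M μ π) < 1 →
        ∑ s, d s * v s ≤
          β ^ 2 / (1 - β) *
            (2 + (1 + β) * inftyNorm (mismatchMatrix M μ π) /
              (1 - β ^ 2 * inftyNorm (mismatchMatrix M μ π)))) := by
  obtain ⟨g, hg, hg'⟩ := tendsto_affine_recursion (β • M.transitionMatrix π)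
    (summable_pow_of_stochastic _ (M.transitionMatrix_nonneg π) (M.transitionMatrix_row_sum π)
      β hβ0 hβ1)
    (fun t s => ∫ ω in {ω | X t ω = s}, emphaticTrace μ π β X U t ω ∂P)
    (fun t s => P.real {ω | X (t + 1) ω = s}) d
    (fun t s => hXU.firstMoment_succ hcov β t s)
    (fun s => (hlim s).comp (tendsto_add_atTop_nat 1))
  obtain ⟨h, hh, hh'⟩ := tendsto_affine_recursion (β ^ 2 • mismatchMatrix M μ π)
    (summable_pow_of_eigenvalueRadius _ _ (sq_nonneg β)
      (sq_mul_lt_one_of_lt_one_div_sqrt hβ0 ENNReal.toReal_nonneg hβ))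
    (fun t s => ∫ ω in {ω | X t ω = s}, emphaticTrace μ π β X U t ω ^ 2 ∂P)
    (fun t s => 2 * ∫ ω in {ω | X (t + 1) ω = s}, emphaticTrace μ π β X U (t + 1) ω ∂P
        - P.real {ω | X (t + 1) ω = s}) (fun s => 2 * g s - d s)
    (fun t s => hXU.secondMoment_succ hcov β t s)
    (fun s => (((hg s).comp (tendsto_add_atTop_nat 1)).const_mul 2).sub
      ((hlim s).comp (tendsto_add_atTop_nat 1)))
  -- Where `d s = 0` the value is immaterial, being multiplied by `d s` in the sum.
  refine ⟨fun s => h s / d s - (g s / d s) ^ 2, fun s hs => ?_, fun hN => ?_⟩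
  · have hlim' := ((hh s).div (hlim s) hs.ne').sub (((hg s).div (hlim s) hs.ne').pow 2)
    refine hlim'.congr' ?_
    -- The moment formula for the variance needs a non-null event `s_t = s`, which holds for large
    -- `t`.
    filter_upwards [(hlim s).eventually_const_lt hs] with t ht
    exact (hXU.condTraceVariance_eq β t s ht.ne').symm
  · exact sum_variance_le_of_moment_equations (M.transitionMatrix π) (mismatchMatrix M μ π) d g h
      β _ hβ1 (M.transitionMatrix_row_sum π) (row_sum_le_inftyNorm _) hd.nonneg hd.sum_eq_one
      (fun s => ge_of_tendsto' (hh s) fun t => integral_nonneg fun ω => sq_nonneg _) hg' hh'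
      (fun s => le_of_tendsto_of_tendsto' ((hg s).pow 2) ((hh s).mul (hlim s))
        fun t => hXU.sq_firstMoment_le β t s) hN
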